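/- Let $M$ be a smooth (Hausdorff) manifold of dimension $m$, let $\mathcal V$ be a smooth distribution of constant dimension $n$ on $M$ (an $n$-dimensional subspace of each tangent space, admitting smooth local bases), and let $F$ be a smooth vector field on $M$. Write $V\in\mathcal V$ if $V$ is a smooth vector field on $M$ with values in $\mathcal V$, and let $\mathcal W=\mathcal V+[F,\mathcal V]$ be the collection of vector fields on $M$ of the form $V_1+[F,V_2]$ with $V_1,V_2\in\mathcal V$. Assume that at every $z\in M$ the values at $z$ of the members of $\mathcal W$ span a $2n$-dimensional subspace of $T_zM$, and that both $\mathcal V$ and $\mathcal W$ are involutive, i.e. $[\mathcal V,\mathcal V]\subset\mathcal V$ and $[\mathcal W,\mathcal W]\subset\mathcal W$. Then every point of $M$ has an open neighbourhood $U$ on which there are smooth vector fields $V_1,\dots,V_n$, forming a basis of $\mathcal V_z$ at each $z\in U$, such that on $U$, for all $i,j$, $[V_i,V_j]=0$ and $[V_i,W_j]$ takes values in $\mathcal V$, where $W_j=[F,V_j]$. -/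

import Mathlib

open scoped Manifold ContDiff

noncomputable section

/-- A (not necessarily smooth) vector field on `M`: a choice of a tangent vector at each point of
a manifold `M` modelled on `ℝ^m`. -/
abbrev VecField (m : ℕ) (M : Type*) [TopologicalSpace M]
    [ChartedSpace (EuclideanSpace ℝ (Fin m)) M] : Type _ :=
  ∀ x : M, TangentSpace (𝓡 m) x

/-- The vector field `X` is smooth on the set `U`, as a section of the tangent bundle. -/
def SmoothVecFieldOn {m : ℕ} {M : Type*} [TopologicalSpace M]
    [ChartedSpace (EuclideanSpace ℝ (Fin m)) M] [IsManifold (𝓡 m) ∞ M]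
    (X : VecField m M) (U : Set M) : Prop :=
  ContMDiffOn (𝓡 m) (𝓡 m).tangent ∞ (fun x => (⟨x, X x⟩ : TangentBundle (𝓡 m) M)) U

/-- The fields `V i`, `i = 0, …, n - 1`, are a smooth basis over `U` of the family `D` of
subspaces of the tangent spaces. -/
structure IsSmoothBasisOn {m n : ℕ} {M : Type*} [TopologicalSpace M]
    [ChartedSpace (EuclideanSpace ℝ (Fin m)) M] [IsManifold (𝓡 m) ∞ M]
    (D : ∀ x : M, Submodule ℝ (TangentSpace (𝓡 m) x)) (V : Fin n → VecField m M)
    (U : Set M) : Prop where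
  smooth : ∀ i, SmoothVecFieldOn (V i) U
  linearIndependent : ∀ x ∈ U, LinearIndependent ℝ (fun i => V i x)
  span_eq : ∀ x ∈ U, Submodule.span ℝ (Set.range fun i => V i x) = D x

/-- A distribution of dimension `n` on `M`: a choice of an `n`-dimensional subspace of the tangent
space at each point, which admits smooth local bases. (That the subspaces have dimension `n`
follows from the existence of local bases with `n` elements.) -/
structure SmoothDistribution (m : ℕ) (M : Type*) [TopologicalSpace M]
    [ChartedSpace (EuclideanSpace ℝ (Fin m)) M] [IsManifold (𝓡 m) ∞ M] (n : ℕ) where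
  space : ∀ x : M, Submodule ℝ (TangentSpace (𝓡 m) x)
  exists_basis : ∀ x : M, ∃ U : Set M, IsOpen U ∧ x ∈ U ∧
    ∃ V : Fin n → VecField m M, IsSmoothBasisOn space V U

/-- The vector fields belonging to a distribution: the smooth vector fields on `M` whose value at
each point lies in the distribution. -/
def SmoothDistribution.fields {m n : ℕ} {M : Type*} [TopologicalSpace M]
    [ChartedSpace (EuclideanSpace ℝ (Fin m)) M] [IsManifold (𝓡 m) ∞ M]
    (D : SmoothDistribution m M n) : Set (VecField m M) :=
  {X | SmoothVecFieldOn X Set.univ ∧ ∀ x, X x ∈ D.space x}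

/-- A collection of vector fields is involutive if it is closed under the Lie bracket. -/
def IsInvolutive {m : ℕ} {M : Type*} [TopologicalSpace M]
    [ChartedSpace (EuclideanSpace ℝ (Fin m)) M] (S : Set (VecField m M)) : Prop :=
  ∀ X ∈ S, ∀ Y ∈ S, VectorField.mlieBracket (𝓡 m) X Y ∈ S

/-- The dimension at `z` of a collection of vector fields: the dimension of the subspace of the
tangent space at `z` spanned by their values at `z`. -/
def dimAt {m : ℕ} {M : Type*} [TopologicalSpace M]
    [ChartedSpace (EuclideanSpace ℝ (Fin m)) M] (S : Set (VecField m M)) (z : M) : ℕ :=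
  Module.finrank ℝ (Submodule.span ℝ ((fun X : VecField m M => X z) '' S))

/-- The collection `𝒱 + [F, 𝒱]` of the vector fields of the form `V₁ + [F, V₂]`, where `V₁`, `V₂`
are vector fields belonging to the distribution `𝒱`. -/
def SmoothDistribution.addBracket {m n : ℕ} {M : Type*} [TopologicalSpace M]
    [ChartedSpace (EuclideanSpace ℝ (Fin m)) M] [IsManifold (𝓡 m) ∞ M]
    (D : SmoothDistribution m M n) (F : VecField m M) : Set (VecField m M) :=
  {X | ∃ V₁ ∈ D.fields, ∃ V₂ ∈ D.fields, X = V₁ + VectorField.mlieBracket (𝓡 m) F V₂}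

end

universe u

section CompositionOperator

open scoped unitInterval

variable {K : Type*} [TopologicalSpace K] [CompactSpace K]
  {G H : Type*} [NormedAddCommGroup G] [NormedSpace ℝ G] [NormedAddCommGroup H] [NormedSpace ℝ H]

/-- Pointwise application of a continuous family of continuous linear maps to a continuous
function. -/
noncomputable def ContinuousMap.applyCLM (K G H : Type*) [TopologicalSpace K] [CompactSpace K]
    [NormedAddCommGroup G] [NormedSpace ℝ G] [NormedAddCommGroup H] [NormedSpace ℝ H] :
    C(K, G →L[ℝ] H) →L[ℝ] C(K, G) →L[ℝ] C(K, H) :=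
  LinearMap.mkContinuous₂
    (LinearMap.mk₂ ℝ (fun (A : C(K, G →L[ℝ] H)) (γ : C(K, G)) =>
        (⟨fun k => A k (γ k), by fun_prop⟩ : C(K, H)))
      (fun _ _ _ => by ext; simp) (fun _ _ _ => by ext; simp)
      (fun _ _ _ => by ext; simp) (fun _ _ _ => by ext; simp)) 1
    (fun A γ => by
      rw [ContinuousMap.norm_le _ (by positivity)]
      intro k
      calc ‖A k (γ k)‖ ≤ ‖A k‖ * ‖γ k‖ := (A k).le_opNorm _
        _ ≤ ‖A‖ * ‖γ‖ := mul_le_mul (ContinuousMap.norm_coe_le_norm _ _)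
            (ContinuousMap.norm_coe_le_norm _ _) (norm_nonneg _)
            ((norm_nonneg _).trans (ContinuousMap.norm_coe_le_norm A k))
        _ = 1 * ‖A‖ * ‖γ‖ := by ring)

@[simp]
theorem ContinuousMap.applyCLM_apply (A : C(K, G →L[ℝ] H)) (γ : C(K, G)) (k : K) :
    ContinuousMap.applyCLM K G H A γ k = A k (γ k) := rfl

theorem ContinuousMap.contDiff_applyCLM {n : WithTop ℕ∞} :
    ContDiff ℝ n (ContinuousMap.applyCLM K G H) := by
  fun_prop

theorem ContinuousMap.isBoundedBilinearMap_applyCLM :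
    IsBoundedBilinearMap ℝ
      (fun q : C(K, G →L[ℝ] H) × C(K, G) => ContinuousMap.applyCLM K G H q.1 q.2) := by
  apply ContinuousLinearMap.isBoundedBilinearMap

/-- The derivative of the composition operator `γ ↦ f ∘ γ`. -/
theorem ContinuousMap.hasFDerivAt_comp (f : C(G, H)) (f' : C(G, G →L[ℝ] H))
    (hf : ∀ x, HasFDerivAt f (f' x) x) (γ : C(K, G)) :
    HasFDerivAt (fun γ : C(K, G) => f.comp γ) (ContinuousMap.applyCLM K G H (f'.comp γ)) γ := by
  rw [hasFDerivAt_iff_isLittleO_nhds_zero, Asymptotics.isLittleO_iff]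
  intro c hc
  have hcont : Continuous (fun ψ : C(K, G) => f'.comp ψ) := ContinuousMap.continuous_postcomp f'
  obtain ⟨δ, hδ, hδc⟩ : ∃ δ > 0, ∀ ⦃ψ : C(K, G)⦄, dist ψ γ < δ →
      dist (f'.comp ψ) (f'.comp γ) < c :=
    Metric.continuous_iff.1 hcont γ c hc
  filter_upwards [Metric.ball_mem_nhds (0 : C(K, G)) hδ] with h hh
  rw [ContinuousMap.norm_le _ (by positivity)]
  intro k
  have hkh : ‖h k‖ ≤ ‖h‖ := ContinuousMap.norm_coe_le_norm _ _
  have hhδ : ‖h‖ < δ := by simpa using hh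
  have key : ‖f (γ k + h k) - f (γ k) - f' (γ k) (γ k + h k - γ k)‖ ≤ c * ‖γ k + h k - γ k‖ := by
    refine (convex_ball (γ k) δ).norm_image_sub_le_of_norm_hasFDerivWithin_le'
      (f := f) (f' := f') (φ := f' (γ k)) (fun x _ => (hf x).hasFDerivWithinAt) ?_
      (Metric.mem_ball_self hδ) (by simpa [dist_eq_norm] using hkh.trans_lt hhδ)
    intro x hx
    have h1 : dist (γ + ContinuousMap.const K (x - γ k)) γ < δ := by
      rw [dist_eq_norm, add_sub_cancel_left]
      refine lt_of_le_of_lt ?_ (show ‖x - γ k‖ < δ by simpa [dist_eq_norm] using hx)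
      exact (ContinuousMap.norm_le _ (norm_nonneg _)).2 fun _ => le_rfl
    have h2 := hδc h1
    have h3 := ContinuousMap.dist_apply_le_dist
      (f := f'.comp (γ + ContinuousMap.const K (x - γ k))) (g := f'.comp γ) k
    rw [dist_eq_norm] at h3
    simpa using (h3.trans h2.le)
  rw [add_sub_cancel_left] at key
  refine le_trans ?_ (key.trans (by gcongr))
  simp

/-- The composition operator `γ ↦ f ∘ γ` is as smooth as `f`. -/
theorem ContinuousMap.contDiff_comp {G H : Type u}
    [NormedAddCommGroup G] [NormedSpace ℝ G] [NormedAddCommGroup H] [NormedSpace ℝ H]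
    (f : C(G, H)) (hf : ContDiff ℝ ∞ f) :
    ContDiff ℝ ∞ (fun γ : C(K, G) => f.comp γ) := by
  rw [contDiff_infty]
  intro n
  induction n generalizing H with
  | zero => exact contDiff_zero.2 (ContinuousMap.continuous_postcomp f)
  | succ n ih =>
    have hf' := contDiff_infty_iff_fderiv.1 hf
    let f' : C(G, G →L[ℝ] H) := ⟨fderiv ℝ f, hf'.2.continuous⟩
    push_cast
    refine contDiff_succ_iff_hasFDerivAt.2
      ⟨fun γ => ContinuousMap.applyCLM K G H (f'.comp γ), ?_,
        fun γ => ContinuousMap.hasFDerivAt_comp f f' (fun x => (hf'.1 x).hasFDerivAt) γ⟩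
    exact ContinuousMap.contDiff_applyCLM.comp (ih f' hf'.2)

/-- The operator of integration `h ↦ ∫ s in 0..t, h s` on continuous functions on `[0, 1]`. -/
noncomputable def ContinuousMap.integralCLM (E : Type*) [NormedAddCommGroup E] [NormedSpace ℝ E] :
    C(I, E) →L[ℝ] C(I, E) :=
  LinearMap.mkContinuous
    { toFun := fun h => ⟨fun t => ∫ s in (0 : ℝ)..t, h (Set.projIcc 0 1 zero_le_one s), by
        have hc : Continuous fun s : ℝ => h (Set.projIcc 0 1 zero_le_one s) :=
          h.continuous.comp continuous_projIcc
        exact (intervalIntegral.continuous_primitive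
          (fun a b => hc.intervalIntegrable a b) 0).comp continuous_subtype_val⟩
      map_add' := fun h g => by
        ext t
        have hc : ∀ h : C(I, E), Continuous fun s : ℝ => h (Set.projIcc 0 1 zero_le_one s) :=
          fun h => h.continuous.comp continuous_projIcc
        exact intervalIntegral.integral_add ((hc h).intervalIntegrable _ _)
          ((hc g).intervalIntegrable _ _)
      map_smul' := fun c h => by
        ext t
        exact intervalIntegral.integral_smul _ _ }
    1
    (fun h => by
      rw [ContinuousMap.norm_le _ (by positivity)]
      intro t
      have := intervalIntegral.norm_integral_le_of_norm_le_const (a := 0) (b := (t : ℝ))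
        (f := fun s : ℝ => h (Set.projIcc 0 1 zero_le_one s)) (C := ‖h‖)
        (fun s _ => ContinuousMap.norm_coe_le_norm _ _)
      refine this.trans ?_
      rw [sub_zero, abs_of_nonneg t.2.1, mul_comm]
      gcongr
      exact t.2.2)

theorem ContinuousMap.integralCLM_apply {E : Type*} [NormedAddCommGroup E] [NormedSpace ℝ E]
    (h : C(I, E)) (t : I) :
    ContinuousMap.integralCLM E h t = ∫ s in (0 : ℝ)..t, h (Set.projIcc 0 1 zero_le_one s) := rfl

end CompositionOperator

section FirstIntegrals

open scoped unitInterval Topology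
open Filter

/-- The smooth implicit function theorem, with smoothness on a neighbourhood. -/
theorem ContDiff.exists_implicitFunction {E₁ E₂ F : Type*}
    [NormedAddCommGroup E₁] [NormedSpace ℝ E₁] [CompleteSpace E₁]
    [NormedAddCommGroup E₂] [NormedSpace ℝ E₂] [CompleteSpace E₂]
    [NormedAddCommGroup F] [NormedSpace ℝ F] [CompleteSpace F]
    {f : E₁ × E₂ → F} (hf : ContDiff ℝ ∞ f) {u : E₁ × E₂} (hu : f u = 0)
    (hinv : (fderiv ℝ f u ∘L .inr ℝ E₁ E₂).IsInvertible) {N : Set E₂} (hN : N ∈ 𝓝 u.2) :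
    ∃ ψ : E₁ → E₂, ψ u.1 = u.2 ∧ ∀ᶠ z in 𝓝 u.1, ContDiffAt ℝ ∞ ψ z ∧ f (z, ψ z) = 0 ∧ ψ z ∈ N ∧
      (fderiv ℝ f (z, ψ z) ∘L .inr ℝ E₁ E₂).IsInvertible := by
  have hne : (∞ : WithTop ℕ∞) ≠ 0 := by simp
  set ψ := hf.contDiffAt.implicitFunction hne hinv with hψ
  have hψu : ψ u.1 = u.2 := hf.contDiffAt.implicitFunction_apply_self hne hinv
  have hψs : ContDiffAt ℝ ∞ ψ u.1 := hf.contDiffAt.contDiffAt_implicitFunction hne hinv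
  have hpair : Tendsto (fun z => (z, ψ z)) (𝓝 u.1) (𝓝 u) := by
    have := (continuousAt_id.prodMk hψs.continuousAt).tendsto
    rw [hψu] at this
    exact this
  have h0 : ∀ᶠ z in 𝓝 u.1, f (z, ψ z) = 0 := by
    filter_upwards [hf.contDiffAt.eventually_apply_implicitFunction hne hinv] with z hz
    rw [hz, hu]
  have hopen : ∀ᶠ z in 𝓝 u.1, (fderiv ℝ f (z, ψ z) ∘L .inr ℝ E₁ E₂).IsInvertible := by
    have hc : Continuous fun v : E₁ × E₂ => fderiv ℝ f v ∘L .inr ℝ E₁ E₂ :=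
      (hf.continuous_fderiv hne).clm_comp continuous_const
    have := (ContinuousLinearEquiv.isOpen (𝕜 := ℝ) (E := E₂) (F := F)).preimage hc
    exact hpair.eventually (this.mem_nhds hinv)
  have hcont : ∀ᶠ z in 𝓝 u.1, ContinuousAt ψ z := by
    filter_upwards [(hψs.of_le (m := 1) (by simp)).eventually (by simp)] with z hz
    exact hz.continuousAt
  have hNev : ∀ᶠ z in 𝓝 u.1, ψ z ∈ N := hψs.continuousAt.eventually (by rwa [hψu])
  refine ⟨ψ, hψu, ?_⟩
  filter_upwards [h0.eventually_nhds, hopen, hcont, hNev] with z hz0 hzi hzc hzN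
  refine ⟨?_, hz0.self_of_nhds, hzN, hzi⟩
  have hs := hf.contDiffAt.contDiffAt_implicitFunction (u := (z, ψ z)) hne hzi
  refine hs.congr_of_eventuallyEq ?_
  have hp : Tendsto (fun y => (y, ψ y)) (𝓝 z) (𝓝 (z, ψ z)) :=
    (continuousAt_id.prodMk hzc).tendsto
  filter_upwards [hp.eventually (hf.contDiffAt.eventually_apply_eq_iff_implicitFunction hne hzi),
    hz0] with y hy hy0
  exact (hy.1 (hy0.trans hz0.self_of_nhds.symm)).symm

/-- The continuous linear map sending a vector to the corresponding constant function. -/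
noncomputable def ContinuousMap.constCLM (K G : Type*) [TopologicalSpace K] [CompactSpace K]
    [NormedAddCommGroup G] [NormedSpace ℝ G] : G →L[ℝ] C(K, G) :=
  LinearMap.mkContinuous
    { toFun := ContinuousMap.const K
      map_add' := fun _ _ => rfl
      map_smul' := fun _ _ => rfl } 1
    (fun x => by
      rw [one_mul]
      exact (ContinuousMap.norm_le _ (norm_nonneg _)).2 fun _ => le_rfl)

@[simp]
theorem ContinuousMap.constCLM_apply {K G : Type*} [TopologicalSpace K] [CompactSpace K]
    [NormedAddCommGroup G] [NormedSpace ℝ G] (x : G) (k : K) :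
    ContinuousMap.constCLM K G x k = x := rfl

variable {E P : Type} [NormedAddCommGroup E] [NormedSpace ℝ E]
  [NormedAddCommGroup P] [NormedSpace ℝ P]

open ContinuousMap

/-- The map whose zeros are the pairs of a point `z` and the solution `γ` on `[0, 1]` of
`γ' = - X γ (π z - π p)`, `γ 0 = z`. -/
noncomputable def flowEquation (X : C(E, P →L[ℝ] E)) (π : E →L[ℝ] P) (p : E)
    (q : E × C(I, E)) : C(I, E) :=
  q.2 - constCLM I E q.1 +
    integralCLM E (applyCLM I P E (X.comp q.2) (constCLM I P (π q.1 - π p)))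

theorem contDiff_flowEquation {X : C(E, P →L[ℝ] E)} (hX : ContDiff ℝ ∞ X) (π : E →L[ℝ] P) (p : E) :
    ContDiff ℝ ∞ (flowEquation X π p) := by
  have h1 : ContDiff ℝ ∞ fun q : E × C(I, E) => X.comp q.2 :=
    (ContinuousMap.contDiff_comp X hX).comp contDiff_snd
  have h2 : ContDiff ℝ ∞ fun q : E × C(I, E) => applyCLM I P E (X.comp q.2) :=
    contDiff_applyCLM.comp h1
  have h3 : ContDiff ℝ ∞ fun q : E × C(I, E) => constCLM I P (π q.1 - π p) :=
    (constCLM I P).contDiff.comp ((π.contDiff.comp contDiff_fst).sub contDiff_const)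
  exact (contDiff_snd.sub ((constCLM I E).contDiff.comp contDiff_fst)).add
    ((integralCLM E).contDiff.comp (h2.clm_apply h3))

theorem fderiv_flowEquation {X : C(E, P →L[ℝ] E)} (hX : ContDiff ℝ ∞ X) (π : E →L[ℝ] P) (p : E)
    (X' : C(E, E →L[ℝ] P →L[ℝ] E)) (hX' : ∀ x, X' x = fderiv ℝ X x)
    (z v : E) (γ δ : C(I, E)) :
    fderiv ℝ (flowEquation X π p) (z, γ) (v, δ) = δ - constCLM I E v +
      integralCLM E (applyCLM I P E (X.comp γ) (constCLM I P (π v)) +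
        applyCLM I P E (applyCLM I E (P →L[ℝ] E) (X'.comp γ) δ) (constCLM I P (π z - π p))) := by
  have hd : ∀ x, HasFDerivAt X (X' x) x := fun x => by
    rw [hX' x]; exact (hX.differentiable (by simp) x).hasFDerivAt
  have h0 := ContinuousMap.hasFDerivAt_comp X X' hd γ
  have h1 := h0.differentiableAt.hasFDerivAt.comp (z, γ)
    (hasFDerivAt_snd (𝕜 := ℝ) (p := (z, γ)))
  have h3 : HasFDerivAt (fun q : E × C(I, E) => constCLM I P (π q.1 - π p))
      ((constCLM I P) ∘L π ∘L .fst ℝ E C(I, E)) (z, γ) :=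
    (constCLM I P).hasFDerivAt.comp (z, γ)
      ((π.hasFDerivAt.comp (z, γ) hasFDerivAt_fst).sub_const _)
  have h4 := ((hasFDerivAt_snd (𝕜 := ℝ) (p := (z, γ))).sub
    ((constCLM I E).hasFDerivAt.comp (z, γ) hasFDerivAt_fst)).add
    ((integralCLM E).hasFDerivAt.comp (z, γ) ((isBoundedBilinearMap_applyCLM.hasFDerivAt (X.comp γ, constCLM I P (π z - π p))).comp
      (z, γ) (h1.prodMk h3)))
  have h5 : HasFDerivAt (flowEquation X π p) _ (z, γ) := h4
  rw [h5.fderiv]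
  rw [← h0.fderiv]
  rfl

/-- The solution `γ` of `flowEquation` is the restriction of a differentiable curve. -/
theorem hasDerivAt_of_flowEquation_eq_zero {X : C(E, P →L[ℝ] E)} {π : E →L[ℝ] P} [CompleteSpace E]
    {p z : E} {γ : C(I, E)} (h : flowEquation X π p (z, γ) = 0) :
    ∃ g : ℝ → E, g 0 = z ∧ (∀ t : I, g t = γ t) ∧
      ∀ s : ℝ, HasDerivAt g (- X (γ (Set.projIcc 0 1 zero_le_one s)) (π z - π p)) s := by
  have hc : Continuous fun s : ℝ => X (γ (Set.projIcc 0 1 zero_le_one s)) (π z - π p) :=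
    (X.continuous.comp (γ.continuous.comp continuous_projIcc)).clm_apply continuous_const
  refine ⟨fun t => z - ∫ s in (0 : ℝ)..t, X (γ (Set.projIcc 0 1 zero_le_one s)) (π z - π p),
    by simp, fun t => ?_, fun s => ?_⟩
  · have := DFunLike.congr_fun h t
    simp only [flowEquation, ContinuousMap.add_apply, ContinuousMap.sub_apply, constCLM_apply,
      integralCLM_apply, applyCLM_apply, ContinuousMap.comp_apply, ContinuousMap.zero_apply] at this
    rw [sub_add_eq_add_sub, sub_eq_zero] at this
    exact (eq_sub_of_add_eq this).symm
  · simpa using ((hc.integral_hasStrictDerivAt 0 s).hasDerivAt.const_sub z)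

theorem fderiv_flowEquation_frame [CompleteSpace E] {X : C(E, P →L[ℝ] E)} (hX : ContDiff ℝ ∞ X)
    {π : E →L[ℝ] P} {p : E} {Ω : Set E} (hπ : ∀ z ∈ Ω, ∀ ξ, π (X z ξ) = ξ)
    (hcomm : ∀ z ∈ Ω, ∀ ξ η, fderiv ℝ X z (X z ξ) η = fderiv ℝ X z (X z η) ξ)
    {z : E} (hz : z ∈ Ω) {γ : C(I, E)} (hγ : ∀ t, γ t ∈ Ω) (h : flowEquation X π p (z, γ) = 0)
    (ξ : P) :
    fderiv ℝ (flowEquation X π p) (z, γ)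
      (X z ξ, ⟨fun t => (1 - (t : ℝ)) • X (γ t) ξ, by fun_prop⟩) = 0 := by
  let X' : C(E, E →L[ℝ] P →L[ℝ] E) := ⟨fderiv ℝ X, hX.continuous_fderiv (by simp)⟩
  rw [fderiv_flowEquation hX π p X' (fun _ => rfl)]
  obtain ⟨g, hg0, hgγ, hg⟩ := hasDerivAt_of_flowEquation_eq_zero h
  ext t
  simp only [ContinuousMap.add_apply, ContinuousMap.sub_apply, constCLM_apply, hπ z hz,
      integralCLM_apply, applyCLM_apply, ContinuousMap.comp_apply, ContinuousMap.zero_apply,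
      ContinuousMap.coe_mk]
  set w := π z - π p
  have key : ∀ s ∈ Set.uIcc (0 : ℝ) t, HasDerivAt (fun s : ℝ => -((1 - s) • X (g s) ξ))
      (X (γ (Set.projIcc 0 1 zero_le_one s)) ξ +
        X' (γ (Set.projIcc 0 1 zero_le_one s))
          ((1 - (Set.projIcc 0 1 zero_le_one s : ℝ)) • X (γ (Set.projIcc 0 1 zero_le_one s)) ξ) w)
        s := by
    intro s hs
    rw [Set.uIcc_of_le t.2.1] at hs
    have hs1 : s ∈ Set.Icc (0 : ℝ) 1 := ⟨hs.1, hs.2.trans t.2.2⟩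
    have hgs : g s = γ (Set.projIcc 0 1 zero_le_one s) := by
      rw [Set.projIcc_of_mem zero_le_one hs1]
      exact hgγ ⟨s, hs1⟩
    have hXg : HasDerivAt (fun s => X (g s)) (X' (g s)
        (- X (γ (Set.projIcc 0 1 zero_le_one s)) w)) s :=
      ((hX.differentiable (by simp) (g s)).hasFDerivAt).comp_hasDerivAt s (hg s)
    have h1 : HasDerivAt (fun s => X (g s) ξ) (X' (g s)
        (- X (γ (Set.projIcc 0 1 zero_le_one s)) w) ξ) s := by
      simpa using hXg.clm_apply (hasDerivAt_const s ξ)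
    have h2 := (((hasDerivAt_id s).const_sub 1).smul h1).neg
    refine h2.congr_deriv ?_
    have hc := hcomm _ (hγ (Set.projIcc 0 1 zero_le_one s)) ξ w
    have hcoe : ((Set.projIcc 0 1 zero_le_one s : I) : ℝ) = s := by
      rw [Set.projIcc_of_mem zero_le_one hs1]
    rw [hcoe, ← hgs]
    rw [← hgs] at hc
    change -((1 - s) • X' (g s) (-(X (g s)) w) ξ + (-1 : ℝ) • X (g s) ξ) = _
    have hc' : X' (g s) (X (g s) ξ) w = X' (g s) (X (g s) w) ξ := hc
    simp only [map_neg, map_smul, _root_.neg_apply, _root_.smul_apply,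
      hc']
    module
  have hcint : Continuous fun s : ℝ => X (γ (Set.projIcc 0 1 zero_le_one s)) ξ +
        X' (γ (Set.projIcc 0 1 zero_le_one s))
          ((1 - (Set.projIcc 0 1 zero_le_one s : ℝ)) • X (γ (Set.projIcc 0 1 zero_le_one s)) ξ)
            w := by
    have hp : Continuous fun s : ℝ => Set.projIcc (0 : ℝ) 1 zero_le_one s := continuous_projIcc
    have hXc : Continuous fun s : ℝ => X (γ (Set.projIcc 0 1 zero_le_one s)) :=
      X.continuous.comp (γ.continuous.comp hp)
    have hXc' : Continuous fun s : ℝ => X' (γ (Set.projIcc 0 1 zero_le_one s)) :=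
      X'.continuous.comp (γ.continuous.comp hp)
    exact (hXc.clm_apply continuous_const).add
      ((hXc'.clm_apply ((continuous_const.sub (continuous_subtype_val.comp hp)).smul
        (hXc.clm_apply continuous_const))).clm_apply continuous_const)
  rw [intervalIntegral.integral_eq_sub_of_hasDerivAt key (hcint.intervalIntegrable _ _),
    hgγ, hg0]
  simp

/-- Smooth first integrals of a commuting frame. -/
theorem exists_firstIntegrals [CompleteSpace E] {X : E → P →L[ℝ] E} (hX : ContDiff ℝ ∞ X)
    {π : E →L[ℝ] P} {Ω : Set E} (hΩ : IsOpen Ω) (hπ : ∀ z ∈ Ω, ∀ ξ, π (X z ξ) = ξ)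
    (hcomm : ∀ z ∈ Ω, ∀ ξ η, fderiv ℝ X z (X z ξ) η = fderiv ℝ X z (X z η) ξ)
    {p : E} (hp : p ∈ Ω) :
    ∃ Y : E → E, (∀ᶠ z in 𝓝 p, ContDiffAt ℝ ∞ Y z ∧ ∀ ξ, fderiv ℝ Y z (X z ξ) = 0) ∧
      ∀ v, fderiv ℝ Y p v = v - X p (π v) := by
  let Xc : C(E, P →L[ℝ] E) := ⟨X, hX.continuous⟩
  have hXc : ContDiff ℝ ∞ Xc := hX
  let X' : C(E, E →L[ℝ] P →L[ℝ] E) := ⟨fderiv ℝ X, hX.continuous_fderiv (by simp)⟩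
  let Φ := flowEquation Xc π p
  have hΦ : ContDiff ℝ ∞ Φ := contDiff_flowEquation hXc π p
  have hΦ' := fderiv_flowEquation hXc π p X' (fun _ => rfl)
  have hu : Φ (p, constCLM I E p) = 0 := by simp [Φ, flowEquation]
  have hinv : fderiv ℝ Φ (p, constCLM I E p) ∘L .inr ℝ E C(I, E) = .id ℝ _ := by
    ext1 δ
    change fderiv ℝ Φ (p, constCLM I E p) (0, δ) = δ
    rw [hΦ']
    simp
  obtain ⟨ε, hε, hεΩ⟩ := Metric.isOpen_iff.1 hΩ p hp
  obtain ⟨ψ, hψp, hψ⟩ := hΦ.exists_implicitFunction hu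
    (by rw [hinv]; exact ⟨.refl ℝ _, rfl⟩) (Metric.ball_mem_nhds (constCLM I E p) hε)
  let ev : C(I, E) →L[ℝ] E := ContinuousMap.evalCLM ℝ (1 : I)
  have hlin : ∀ z, ContDiffAt ℝ ∞ ψ z → (∀ᶠ y in 𝓝 z, Φ (y, ψ y) = 0) → ∀ v,
      fderiv ℝ Φ (z, ψ z) (v, fderiv ℝ ψ z v) = 0 := by
    intro z hz h0 v
    have h1 : HasFDerivAt (fun y => (y, ψ y)) ((ContinuousLinearMap.id ℝ E).prod (fderiv ℝ ψ z)) z :=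
      (hasFDerivAt_id z).prodMk (hz.differentiableAt (by simp)).hasFDerivAt
    have h2 := ((hΦ.differentiable (by simp) (z, ψ z)).hasFDerivAt).comp z h1
    have h3 : HasFDerivAt (fun y => Φ (y, ψ y)) (0 : E →L[ℝ] C(I, E)) z :=
      (hasFDerivAt_const (0 : C(I, E)) z).congr_of_eventuallyEq h0
    exact DFunLike.congr_fun (h2.unique h3) v
  have hY' : ∀ z, ContDiffAt ℝ ∞ ψ z → ∀ v,
      fderiv ℝ (fun z => ev (ψ z)) z v = fderiv ℝ ψ z v 1 := by
    intro z hz v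
    have := ev.hasFDerivAt.comp z (hz.differentiableAt (by simp)).hasFDerivAt
    exact DFunLike.congr_fun this.fderiv v
  have h0ev : ∀ᶠ z in 𝓝 p, Φ (z, ψ z) = 0 := hψ.mono fun z hz => hz.2.1
  refine ⟨fun z => ev (ψ z), ?_, fun v => ?_⟩
  · filter_upwards [hψ, h0ev.eventually_nhds, hΩ.mem_nhds hp] with z hz hz0 hzΩ
    obtain ⟨hzs, hz0', hzball, hzi⟩ := hz
    refine ⟨ev.contDiff.contDiffAt.comp z hzs, fun ξ => ?_⟩
    rw [hY' z hzs]
    have hγ : ∀ t, ψ z t ∈ Ω := fun t => hεΩ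
      (lt_of_le_of_lt (ContinuousMap.dist_apply_le_dist (g := constCLM I E p) t) hzball)
    have h1 := fderiv_flowEquation_frame hXc hπ hcomm hzΩ hγ hz0' ξ
    have h2 := hlin z hzs hz0 (X z ξ)
    have h3 : fderiv ℝ ψ z (X z ξ) = ⟨fun t => (1 - (t : ℝ)) • Xc (ψ z t) ξ, by fun_prop⟩ := by
      apply hzi.injective
      change fderiv ℝ Φ (z, ψ z) (0, _) = fderiv ℝ Φ (z, ψ z) (0, _)
      have h4 : ∀ δ : C(I, E), fderiv ℝ Φ (z, ψ z) (0, δ) =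
          fderiv ℝ Φ (z, ψ z) (X z ξ, δ) - fderiv ℝ Φ (z, ψ z) (X z ξ, 0) := fun δ => by
        rw [← map_sub]
        simp
      refine (h4 _).trans (Eq.trans ?_ (h4 _).symm)
      congr 1
      exact h2.trans h1.symm
    rw [h3]
    simp
  · have hs := hψ.self_of_nhds.1
    rw [hY' p hs]
    have := hlin p hs h0ev v
    rw [hψp, hΦ'] at this
    have h1 := DFunLike.congr_fun this 1
    simp [integralCLM_apply, Xc] at h1
    rw [← sub_eq_zero, ← h1]
    abel

end FirstIntegrals

section LocalNormalForm

open scoped Topology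
open Filter VectorField

variable {E P : Type} [NormedAddCommGroup E] [NormedSpace ℝ E] [FiniteDimensional ℝ E]
  [NormedAddCommGroup P] [NormedSpace ℝ P] [FiniteDimensional ℝ P]

/-- The vector field `S` is, in a neighbourhood of `z`, a smooth section of the family `D` of
subspaces. -/
def IsSectionNear (D : E → Submodule ℝ E) (S : E → E) (z : E) : Prop :=
  ∀ᶠ y in 𝓝 z, ContDiffAt ℝ ∞ S y ∧ S y ∈ D y

theorem ContDiffAt.fderiv_apply_vectorField {F : Type*} [NormedAddCommGroup F] [NormedSpace ℝ F]
    {f : E → F} {V : E → E} {z : E} (hf : ContDiffAt ℝ ∞ f z) (hV : ContDiffAt ℝ ∞ V z) :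
    ContDiffAt ℝ ∞ (fun y => fderiv ℝ f y (V y)) z :=
  (hf.fderiv_right (m := ∞) (by simp)).clm_apply hV

theorem ContDiffAt.fderiv_lieBracket_apply {F : Type*} [NormedAddCommGroup F] [NormedSpace ℝ F]
    {f : E → F} {V W : E → E} {z : E} (hf : ContDiffAt ℝ ∞ f z) (hV : ContDiffAt ℝ ∞ V z)
    (hW : ContDiffAt ℝ ∞ W z) :
    fderiv ℝ f z (lieBracket ℝ V W z) =
      fderiv ℝ (fun y => fderiv ℝ f y (W y)) z (V z) -
        fderiv ℝ (fun y => fderiv ℝ f y (V y)) z (W z) :=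
  fderiv_apply_lieBracket hf (by
    rw [minSmoothness_of_isRCLikeNormedField]
    exact ENat.LEInfty.out) (hW.differentiableAt (by simp))
    (hV.differentiableAt (by simp))

/-- If two functions have constant derivative along two vector fields, they have zero derivative
along the bracket. -/
theorem fderiv_lieBracket_eq_zero {F : Type*} [NormedAddCommGroup F] [NormedSpace ℝ F]
    {f : E → F} {V W : E → E} {z : E} (hf : ContDiffAt ℝ ∞ f z) (hV : ContDiffAt ℝ ∞ V z)
    (hW : ContDiffAt ℝ ∞ W z) {a b : F} (ha : ∀ᶠ y in 𝓝 z, fderiv ℝ f y (V y) = a)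
    (hb : ∀ᶠ y in 𝓝 z, fderiv ℝ f y (W y) = b) :
    fderiv ℝ f z (lieBracket ℝ V W z) = 0 := by
  have ha' : (fun y => fderiv ℝ f y (V y)) =ᶠ[𝓝 z] fun _ => a := ha
  have hb' : (fun y => fderiv ℝ f y (W y)) =ᶠ[𝓝 z] fun _ => b := hb
  rw [hf.fderiv_lieBracket_apply hV hW, ha'.fderiv_eq, hb'.fderiv_eq]
  simp

/-- A frame of an involutive distribution can be normalised with respect to functions which are
independent along the distribution; the normalised frame commutes. -/
theorem exists_normalized_frame {D : E → Submodule ℝ E} {X : E → P →L[ℝ] E} {p : E}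
    (hX : ∀ᶠ z in 𝓝 p, ContDiffAt ℝ ∞ X z ∧ (X z).range = D z)
    (hD : ∀ᶠ z in 𝓝 p, ∀ S T, IsSectionNear D S z → IsSectionNear D T z →
      lieBracket ℝ S T z ∈ D z)
    {u : E → P} (hu : ∀ᶠ z in 𝓝 p, ContDiffAt ℝ ∞ u z)
    (hinv : (fderiv ℝ u p ∘L X p).IsInvertible) :
    ∃ X' : E → P →L[ℝ] E, ∀ᶠ z in 𝓝 p, ContDiffAt ℝ ∞ X' z ∧ (X' z).range = D z ∧
      (∀ ξ, fderiv ℝ u z (X' z ξ) = ξ) ∧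
      ∀ ξ η, lieBracket ℝ (fun y => X' y ξ) (fun y => X' y η) z = 0 := by
  have : CompleteSpace P := FiniteDimensional.complete ℝ P
  let A : E → P →L[ℝ] P := fun z => fderiv ℝ u z ∘L X z
  have hA : ∀ᶠ z in 𝓝 p, ContDiffAt ℝ ∞ A z := by
    filter_upwards [hX, hu] with z hz hz'
    exact (hz'.fderiv_right (m := ∞) (by simp)).clm_comp hz.1
  have hAinv : ∀ᶠ z in 𝓝 p, (A z).IsInvertible :=
    hA.self_of_nhds.continuousAt.eventually
      ((ContinuousLinearEquiv.isOpen (𝕜 := ℝ) (E := P) (F := P)).mem_nhds hinv)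
  let X' : E → P →L[ℝ] E := fun z => X z ∘L (A z).inverse
  have h1 : ∀ᶠ z in 𝓝 p, ContDiffAt ℝ ∞ X' z ∧ (X' z).range = D z ∧
      (∀ ξ, fderiv ℝ u z (X' z ξ) = ξ) := by
    filter_upwards [hX, hA, hAinv] with z hz hzA hzi
    refine ⟨hz.1.clm_comp (hzi.contDiffAt_map_inverse.comp z hzA), ?_,
      fun ξ => hzi.self_apply_inverse ξ⟩
    rw [← hz.2]
    apply le_antisymm
    · rintro _ ⟨ξ, rfl⟩
      exact ⟨(A z).inverse ξ, rfl⟩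
    · rintro _ ⟨ξ, rfl⟩
      exact ⟨A z ξ, congrArg (X z) (hzi.inverse_apply_self ξ)⟩
  refine ⟨X', ?_⟩
  filter_upwards [h1.eventually_nhds, hD, hu] with z hz hzD hzu
  refine ⟨hz.self_of_nhds.1, hz.self_of_nhds.2.1, hz.self_of_nhds.2.2, fun ξ η => ?_⟩
  have hS : ∀ ξ, IsSectionNear D (fun y => X' y ξ) z := fun ξ => by
    filter_upwards [hz] with y hy
    exact ⟨hy.1.clm_apply contDiffAt_const, hy.2.1 ▸ ⟨ξ, rfl⟩⟩
  have hmem := hzD _ _ (hS ξ) (hS η)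
  rw [← hz.self_of_nhds.2.1] at hmem
  obtain ⟨ζ, hζ⟩ := hmem
  have h0 := fderiv_lieBracket_eq_zero hzu (hS ξ).self_of_nhds.1 (hS η).self_of_nhds.1
    (hz.mono fun y hy => hy.2.2 ξ) (hz.mono fun y hy => hy.2.2 η)
  rw [← hζ] at h0 ⊢
  have h2 : ζ = 0 := (hz.self_of_nhds.2.2 ζ).symm.trans h0
  rw [h2]
  exact map_zero (X' z)

/-- A function which is smooth near a point coincides near this point with a smooth function. -/
theorem exists_contDiff_eventuallyEq {F : Type*} [NormedAddCommGroup F] [NormedSpace ℝ F]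
    {f : E → F} {p : E} (hf : ∀ᶠ z in 𝓝 p, ContDiffAt ℝ ∞ f z) :
    ∃ g : E → F, ContDiff ℝ ∞ g ∧ g =ᶠ[𝓝 p] f := by
  obtain ⟨r, hr, hrf⟩ := Metric.eventually_nhds_iff_ball.1 hf
  let χ : ContDiffBump p := ⟨r / 4, r / 2, by linarith, by linarith⟩
  refine ⟨fun z => χ z • f z, ?_, ?_⟩
  · rw [contDiff_iff_contDiffAt]
    intro z
    by_cases hz : z ∈ Metric.ball p r
    · exact χ.contDiff.contDiffAt.smul (hrf z hz)
    · have : z ∉ tsupport χ := by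
        rw [χ.tsupport_eq]
        intro h
        apply hz
        exact Metric.closedBall_subset_ball (show r / 2 < r by linarith) h
      have h0 : (fun z => χ z • f z) =ᶠ[𝓝 z] fun _ => 0 := by
        filter_upwards [notMem_tsupport_iff_eventuallyEq.1 this] with y hy
        simp [hy]
      exact contDiffAt_const.congr_of_eventuallyEq h0
  · filter_upwards [χ.eventuallyEq_one] with y hy
    simp [hy]

/-- An injective continuous linear map between finite-dimensional spaces has a left inverse. -/
theorem ContinuousLinearMap.exists_leftInverse {A : P →L[ℝ] E} (hA : Function.Injective A) :
    ∃ R : E →L[ℝ] P, R ∘L A = .id ℝ P := by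
  obtain ⟨g, hg⟩ := A.toLinearMap.exists_leftInverse_of_injective (LinearMap.ker_eq_bot.2 hA)
  exact ⟨g.toContinuousLinearMap, by ext x; exact DFunLike.congr_fun hg x⟩

/-- **Frobenius theorem**: near any point, an involutive distribution is the kernel of the
derivative of a smooth map. -/
theorem exists_firstIntegrals_of_involutive {D : E → Submodule ℝ E} {X : E → P →L[ℝ] E} {p : E}
    (hX : ∀ᶠ z in 𝓝 p, ContDiffAt ℝ ∞ X z ∧ Function.Injective (X z) ∧ (X z).range = D z)
    (hD : ∀ᶠ z in 𝓝 p, ∀ S T, IsSectionNear D S z → IsSectionNear D T z →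
      lieBracket ℝ S T z ∈ D z) :
    ∃ Y : E → E, (∀ᶠ z in 𝓝 p, ContDiffAt ℝ ∞ Y z ∧ ∀ v ∈ D z, fderiv ℝ Y z v = 0) ∧
      ∀ v, fderiv ℝ Y p v = 0 → v ∈ D p := by
  have : CompleteSpace E := FiniteDimensional.complete ℝ E
  obtain ⟨π, hπ⟩ := ContinuousLinearMap.exists_leftInverse hX.self_of_nhds.2.1
  obtain ⟨X₁, hX₁⟩ := exists_normalized_frame (hX.mono fun z hz => ⟨hz.1, hz.2.2⟩) hD (u := π)
    (Eventually.of_forall fun z => π.contDiff.contDiffAt)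
    (by rw [π.fderiv, hπ]; exact ⟨.refl ℝ _, rfl⟩)
  obtain ⟨X₂, hX₂, hX₂₁⟩ := exists_contDiff_eventuallyEq (hX₁.mono fun z hz => hz.1)
  have hall : ∀ᶠ z in 𝓝 p, (X₂ z).range = D z ∧ (∀ ξ, π (X₂ z ξ) = ξ) ∧
      ∀ ξ η, fderiv ℝ X₂ z (X₂ z ξ) η = fderiv ℝ X₂ z (X₂ z η) ξ := by
    filter_upwards [hX₂₁.eventually_nhds, hX₁] with z hz hz₁
    have hzz : X₂ z = X₁ z := hz.self_of_nhds
    rw [hzz]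
    refine ⟨hz₁.2.1, fun ξ => by simpa using hz₁.2.2.1 ξ, fun ξ η => ?_⟩
    have hd : ∀ ξ, fderiv ℝ (fun y => X₁ y ξ) z = (fderiv ℝ X₂ z).flip ξ := fun ξ => by
      have h1 : (fun y => X₁ y ξ) =ᶠ[𝓝 z] fun y => X₂ y ξ := by
        filter_upwards [hz] with y hy
        rw [hy]
      have h2 := ((hX₂.differentiable (by simp) z).hasFDerivAt).clm_apply (hasFDerivAt_const ξ z)
      rw [h1.fderiv_eq, h2.fderiv]
      simp
    have h3 := hz₁.2.2.2 ξ η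
    rw [lieBracket, hd, hd, sub_eq_zero] at h3
    exact h3
  obtain ⟨r, hr, hrΩ⟩ := Metric.eventually_nhds_iff_ball.1 hall
  obtain ⟨Y, hY, hYp⟩ := exists_firstIntegrals hX₂ (π := π) (Metric.isOpen_ball (x := p) (ε := r))
    (fun z hz => (hrΩ z hz).2.1) (fun z hz => (hrΩ z hz).2.2) (Metric.mem_ball_self hr)
  refine ⟨Y, ?_, fun v hv => ?_⟩
  · filter_upwards [hY, hall] with z hz hz'
    refine ⟨hz.1, fun v hv => ?_⟩
    rw [← hz'.1] at hv
    obtain ⟨ξ, rfl⟩ := hv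
    exact hz.2 ξ
  · rw [hYp, sub_eq_zero] at hv
    rw [hv, ← hall.self_of_nhds.1]
    exact ⟨π v, rfl⟩

/-- A linear map whose kernel on a subspace `W` of dimension `2 n` is contained in an
`n`-dimensional space has an image of `W` of dimension at least `n`. -/
theorem Submodule.le_finrank_map_of_ker_le {F : Type*} [AddCommGroup F] [Module ℝ F]
    {W D : Submodule ℝ E} {f : E →ₗ[ℝ] F} (h : W ⊓ LinearMap.ker f ≤ D) :
    Module.finrank ℝ W ≤ Module.finrank ℝ (W.map f) + Module.finrank ℝ D := by
  have h1 := LinearMap.finrank_range_add_finrank_ker (f.domRestrict W)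
  have h2 : LinearMap.range (f.domRestrict W) = W.map f := LinearMap.range_domRestrict W f
  have h3 : Module.finrank ℝ (LinearMap.ker (f.domRestrict W)) ≤ Module.finrank ℝ D := by
    rw [← Submodule.finrank_map_subtype_eq]
    apply Submodule.finrank_mono
    rintro _ ⟨w, hw, rfl⟩
    exact h ⟨w.2, hw⟩
  rw [h2] at h1
  omega

/-- First integrals of `D`, applied to `[F, T]` for a section `T` of `D`. -/
theorem fderiv_lieBracket_section {G : Type*} [NormedAddCommGroup G] [NormedSpace ℝ G]
    {D : E → Submodule ℝ E} {f : E → G} {F T : E → E} {z : E}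
    (hf : ∀ᶠ y in 𝓝 z, ContDiffAt ℝ ∞ f y ∧ ∀ v ∈ D y, fderiv ℝ f y v = 0)
    (hF : ContDiffAt ℝ ∞ F z) (hT : IsSectionNear D T z) :
    fderiv ℝ f z (lieBracket ℝ F T z) = -fderiv ℝ (fun y => fderiv ℝ f y (F y)) z (T z) := by
  have h0 : (fun y => fderiv ℝ f y (T y)) =ᶠ[𝓝 z] fun _ => 0 := by
    filter_upwards [hf, hT] with y hy hyT
    exact hy.2 _ hyT.2
  rw [hf.self_of_nhds.1.fderiv_lieBracket_apply hF hT.self_of_nhds.1, h0.fderiv_eq]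
  simp

/-- The local normal form theorem, in a vector space. -/
theorem exists_normal_frame {D W : E → Submodule ℝ E} {X : E → P →L[ℝ] E} {F : E → E} {p : E}
    (hX : ∀ᶠ z in 𝓝 p, ContDiffAt ℝ ∞ X z ∧ Function.Injective (X z) ∧ (X z).range = D z)
    (hF : ∀ᶠ z in 𝓝 p, ContDiffAt ℝ ∞ F z)
    (hDD : ∀ᶠ z in 𝓝 p, ∀ S T, IsSectionNear D S z → IsSectionNear D T z →
      lieBracket ℝ S T z ∈ D z)
    (hDW : ∀ᶠ z in 𝓝 p, ∀ S T, IsSectionNear D S z → IsSectionNear D T z →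
      lieBracket ℝ S (lieBracket ℝ F T) z ∈ W z)
    (hFW : ∀ᶠ z in 𝓝 p, ∀ T, IsSectionNear D T z → lieBracket ℝ F T z ∈ W z)
    (hle : ∀ᶠ z in 𝓝 p, D z ≤ W z)
    (hdim : ∀ᶠ z in 𝓝 p, Module.finrank ℝ (W z) = 2 * Module.finrank ℝ P)
    (hWp : W p ≤ Submodule.span ℝ
      {v | ∃ d ∈ D p, ∃ T, IsSectionNear D T p ∧ v = d + lieBracket ℝ F T p}) :
    ∃ X' : E → P →L[ℝ] E, ∀ᶠ z in 𝓝 p, ContDiffAt ℝ ∞ X' z ∧ Function.Injective (X' z) ∧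
      (X' z).range = D z ∧
      (∀ ξ η, lieBracket ℝ (fun y => X' y ξ) (fun y => X' y η) z = 0) ∧
      ∀ ξ η, lieBracket ℝ (fun y => X' y ξ) (lieBracket ℝ F fun y => X' y η) z ∈ D z := by
  obtain ⟨Y, hY, hYp⟩ := exists_firstIntegrals_of_involutive hX hDD
  have hrank : ∀ {z : E} {A : P →L[ℝ] E}, Function.Injective A → A.range = D z →
      Module.finrank ℝ (D z) = Module.finrank ℝ P := fun {z A} hA hr => by
    rw [← hr]
    exact LinearMap.finrank_range_of_inj hA
  set L : E →L[ℝ] E := fderiv ℝ (fun y => fderiv ℝ Y y (F y)) p with hL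
  have hmap : (W p).map (fderiv ℝ Y p).toLinearMap ≤ LinearMap.range (L ∘L X p).toLinearMap := by
    rw [Submodule.map_le_iff_le_comap]
    refine hWp.trans (Submodule.span_le.2 ?_)
    rintro _ ⟨d, hd, T, hT, rfl⟩
    obtain ⟨ξ, hξ⟩ : T p ∈ (X p).range := hX.self_of_nhds.2.2 ▸ hT.self_of_nhds.2
    refine ⟨-ξ, ?_⟩
    change L (X p (-ξ)) = fderiv ℝ Y p (d + lieBracket ℝ F T p)
    rw [map_add, hY.self_of_nhds.2 d hd, fderiv_lieBracket_section hY hF.self_of_nhds hT, ← hξ]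
    simp [hL]
  have hinj : Function.Injective (L ∘L X p) := by
    have h1 := Submodule.le_finrank_map_of_ker_le (W := W p) (D := D p)
      (f := (fderiv ℝ Y p).toLinearMap) (fun v hv => hYp v hv.2)
    have h2 := Submodule.finrank_mono hmap
    have h3 := LinearMap.finrank_range_add_finrank_ker (L ∘L X p).toLinearMap
    rw [hdim.self_of_nhds, hrank hX.self_of_nhds.2.1 hX.self_of_nhds.2.2] at h1
    have h4 : Module.finrank ℝ (LinearMap.ker (L ∘L X p).toLinearMap) = 0 := by omega
    exact LinearMap.ker_eq_bot.1 (Submodule.finrank_eq_zero.1 h4)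
  obtain ⟨R, hR⟩ := ContinuousLinearMap.exists_leftInverse hinj
  let f : E → P := fun z => R (Y z)
  have hfd : ∀ z, ContDiffAt ℝ ∞ Y z → ∀ v, fderiv ℝ f z v = R (fderiv ℝ Y z v) :=
    fun z hz v => DFunLike.congr_fun
      (R.hasFDerivAt.comp z (hz.differentiableAt (by simp)).hasFDerivAt).fderiv v
  have hf : ∀ᶠ z in 𝓝 p, ContDiffAt ℝ ∞ f z ∧ ∀ v ∈ D z, fderiv ℝ f z v = 0 := by
    filter_upwards [hY] with z hz
    refine ⟨R.contDiff.contDiffAt.comp z hz.1, fun v hv => ?_⟩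
    rw [hfd z hz.1, hz.2 v hv, map_zero]
  let u : E → P := fun y => fderiv ℝ f y (F y)
  have hu : ∀ᶠ z in 𝓝 p, ContDiffAt ℝ ∞ u z := by
    filter_upwards [hf, hF] with z hz hzF
    exact hz.1.fderiv_apply_vectorField hzF
  have hup : fderiv ℝ u p = R ∘L L := by
    have h1 : u =ᶠ[𝓝 p] fun y => R (fderiv ℝ Y y (F y)) := by
      filter_upwards [hY] with y hy
      exact hfd y hy.1 _
    rw [h1.fderiv_eq]
    exact (R.hasFDerivAt.comp p ((hY.self_of_nhds.1.fderiv_apply_vectorField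
      hF.self_of_nhds).differentiableAt (by simp)).hasFDerivAt).fderiv
  obtain ⟨X', hX'⟩ := exists_normalized_frame (hX.mono fun z hz => ⟨hz.1, hz.2.2⟩) hDD hu
    (by rw [hup, ContinuousLinearMap.comp_assoc, hR]; exact ⟨.refl ℝ _, rfl⟩)
  refine ⟨X', ?_⟩
  filter_upwards [hX'.eventually_nhds, hf.eventually_nhds, hF.eventually_nhds, hDW, hFW, hle, hdim]
    with z hX'z hfz hFz hDWz hFWz hlez hdimz
  have hz := hX'z.self_of_nhds
  have hzinj : Function.Injective (X' z) := fun ξ η h => by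
    rw [← hz.2.2.1 ξ, ← hz.2.2.1 η, h]
  refine ⟨hz.1, hzinj, hz.2.1, hz.2.2.2, fun ξ η => ?_⟩
  have hS : ∀ ξ, ∀ᶠ y in 𝓝 z, IsSectionNear D (fun y => X' y ξ) y := fun ξ => by
    filter_upwards [hX'z.eventually_nhds] with y hy
    filter_upwards [hy] with x hx
    exact ⟨hx.1.clm_apply contDiffAt_const, hx.2.1 ▸ ⟨ξ, rfl⟩⟩
  have hFT : ∀ η, ∀ᶠ y in 𝓝 z, fderiv ℝ f y (lieBracket ℝ F (fun y => X' y η) y) = -η := fun η => by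
    filter_upwards [hfz.eventually_nhds, hFz, hS η, hX'z] with y hfy hFy hSy hX'y
    rw [fderiv_lieBracket_section hfy hFy hSy]
    exact congrArg Neg.neg (hX'y.2.2.1 η)
  have hker : fderiv ℝ f z
      (lieBracket ℝ (fun y => X' y ξ) (lieBracket ℝ F fun y => X' y η) z) = 0 := by
    refine fderiv_lieBracket_eq_zero hfz.self_of_nhds.1 (hS ξ).self_of_nhds.self_of_nhds.1
      (hFz.self_of_nhds.lieBracket_vectorField (m := ∞) (n := ∞)
        (hS η).self_of_nhds.self_of_nhds.1 (by simp)) (a := 0) ?_ (hFT η)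
    filter_upwards [hfz, hS ξ] with y hfy hSy
    exact hfy.2 _ hSy.self_of_nhds.2
  have hmemW := hDWz _ _ (hS ξ).self_of_nhds (hS η).self_of_nhds
  have hDk : D z ≤ W z ⊓ LinearMap.ker (fderiv ℝ f z).toLinearMap :=
    fun v hv => ⟨hlez hv, hfz.self_of_nhds.2 v hv⟩
  have hDeq : D z = W z ⊓ LinearMap.ker (fderiv ℝ f z).toLinearMap := by
    refine Submodule.eq_of_le_of_finrank_le hDk ?_
    have h1 := LinearMap.finrank_range_add_finrank_ker
      ((fderiv ℝ f z).toLinearMap.domRestrict (W z))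
    have h2 : LinearMap.range ((fderiv ℝ f z).toLinearMap.domRestrict (W z)) = ⊤ := by
      rw [LinearMap.range_eq_top]
      intro η
      refine ⟨⟨_, hFWz _ (hS (-η)).self_of_nhds⟩, ?_⟩
      have := (hFT (-η)).self_of_nhds
      rwa [neg_neg] at this
    have h3 : (LinearMap.ker ((fderiv ℝ f z).toLinearMap.domRestrict (W z))).map (W z).subtype =
        W z ⊓ LinearMap.ker (fderiv ℝ f z).toLinearMap := by
      ext v
      simp [and_comm]
    rw [h2, finrank_top, hdimz] at h1
    rw [← h3, Submodule.finrank_map_subtype_eq, hrank hzinj hz.2.1]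
    omega
  rw [hDeq]
  exact ⟨hmemW, hker⟩

end LocalNormalForm

section Charts

open scoped Topology
open Filter VectorField

theorem ContinuousLinearMap.IsInvertible.finrank_comap {E₁ E₂ : Type*} [AddCommGroup E₁]
    [TopologicalSpace E₁] [Module ℝ E₁] [AddCommGroup E₂] [TopologicalSpace E₂] [Module ℝ E₂]
    {A : E₁ →L[ℝ] E₂} (hA : A.IsInvertible) (W : Submodule ℝ E₂) :
    Module.finrank ℝ (W.comap A.toLinearMap) = Module.finrank ℝ W := by
  obtain ⟨A, rfl⟩ := hA
  exact (A.toLinearEquiv.ofSubmodule' W).finrank_eq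

theorem ContinuousLinearMap.IsInvertible.comap_span_le {E₁ E₂ : Type*} [AddCommGroup E₁]
    [TopologicalSpace E₁] [Module ℝ E₁] [AddCommGroup E₂] [TopologicalSpace E₂] [Module ℝ E₂]
    {A : E₁ →L[ℝ] E₂} (hA : A.IsInvertible) {S : Set E₂} {T : Submodule ℝ E₁}
    (h : ∀ s ∈ S, ∃ v ∈ T, A v = s) : (Submodule.span ℝ S).comap A.toLinearMap ≤ T := by
  have h1 : Submodule.span ℝ S ≤ T.map A.toLinearMap := Submodule.span_le.2 h
  rintro v hv
  obtain ⟨w, hw, hwv⟩ := h1 hv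
  rwa [← hA.injective hwv]

theorem VectorField.mlieBracket_eq_lieBracket {E : Type*} [NormedAddCommGroup E] [NormedSpace ℝ E]
    {V W : ∀ x : E, TangentSpace 𝓘(ℝ, E) x} :
    mlieBracket 𝓘(ℝ, E) V W = lieBracket ℝ V W := by
  rw [← mlieBracketWithin_univ, mlieBracketWithin_eq_lieBracketWithin]
  exact lieBracketWithin_univ

variable {m : ℕ} {M : Type*} [TopologicalSpace M]
    [ChartedSpace (EuclideanSpace ℝ (Fin m)) M]

local notation "𝔼" => EuclideanSpace ℝ (Fin m)

/-- The vector field on the manifold which is represented by `S` in the chart at `z₀`. -/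
noncomputable def ofChart (z₀ : M) (S : EuclideanSpace ℝ (Fin m) → EuclideanSpace ℝ (Fin m)) :
    VecField m M :=
  mpullback (𝓡 m) 𝓘(ℝ, EuclideanSpace ℝ (Fin m)) (extChartAt (𝓡 m) z₀) S

/-- The representation of the vector field `X` in the chart at `z₀`. -/
noncomputable def toChart (z₀ : M) (X : VecField m M) :
    EuclideanSpace ℝ (Fin m) → EuclideanSpace ℝ (Fin m) :=
  mpullback 𝓘(ℝ, EuclideanSpace ℝ (Fin m)) (𝓡 m) (extChartAt (𝓡 m) z₀).symm X

/-- The vector field `X` is smooth at `z`. -/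
def SmoothVecFieldAt (X : VecField m M) (z : M) [IsManifold (𝓡 m) ∞ M] : Prop :=
  ContMDiffAt (𝓡 m) (𝓡 m).tangent ∞ (fun x => (⟨x, X x⟩ : TangentBundle (𝓡 m) M)) z

/-- The family of subspaces `W` in the chart at `z₀`. -/
noncomputable def subspaceInChart (z₀ : M) (W : ∀ x : M, Submodule ℝ (TangentSpace (𝓡 m) x))
    (e : EuclideanSpace ℝ (Fin m)) : Submodule ℝ (EuclideanSpace ℝ (Fin m)) :=
  (W ((extChartAt (𝓡 m) z₀).symm e)).comap
    (mfderiv (𝓡 m) 𝓘(ℝ, EuclideanSpace ℝ (Fin m)) (extChartAt (𝓡 m) z₀)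
      ((extChartAt (𝓡 m) z₀).symm e)).inverse.toLinearMap

variable {z₀ : M}

theorem ofChart_symm_apply {e : 𝔼} (he : e ∈ (extChartAt (𝓡 m) z₀).target) (S : 𝔼 → 𝔼) :
    ofChart z₀ S ((extChartAt (𝓡 m) z₀).symm e) =
      (mfderiv (𝓡 m) 𝓘(ℝ, EuclideanSpace ℝ (Fin m)) (extChartAt (𝓡 m) z₀)
        ((extChartAt (𝓡 m) z₀).symm e)).inverse (S e) := by
  exact congrArg (fun v : 𝔼 => (mfderiv (𝓡 m) 𝓘(ℝ, EuclideanSpace ℝ (Fin m)) (extChartAt (𝓡 m) z₀)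
        ((extChartAt (𝓡 m) z₀).symm e)).inverse (S v)) ((extChartAt (𝓡 m) z₀).right_inv he)

theorem ofChart_add (S T : 𝔼 → 𝔼) (z : M) :
    ofChart z₀ (S + T) z = ofChart z₀ S z + ofChart z₀ T z :=
  mpullback_add_apply

theorem mem_subspaceInChart {W : ∀ x : M, Submodule ℝ (TangentSpace (𝓡 m) x)}
    {e : 𝔼} (he : e ∈ (extChartAt (𝓡 m) z₀).target) (S : 𝔼 → 𝔼) :
    S e ∈ subspaceInChart z₀ W e ↔
      ofChart z₀ S ((extChartAt (𝓡 m) z₀).symm e) ∈ W ((extChartAt (𝓡 m) z₀).symm e) := by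
  rw [ofChart_symm_apply he]
  rfl

theorem eventually_extChartAt {p : 𝔼 → Prop} {e : 𝔼} (he : e ∈ (extChartAt (𝓡 m) z₀).target)
    (h : ∀ᶠ y in 𝓝 e, p y) :
    ∀ᶠ z in 𝓝 ((extChartAt (𝓡 m) z₀).symm e), p (extChartAt (𝓡 m) z₀ z) := by
  have hc := continuousAt_extChartAt' (I := 𝓡 m) ((extChartAt (𝓡 m) z₀).map_target he)
  refine hc.eventually ?_
  rwa [(extChartAt (𝓡 m) z₀).right_inv he]

theorem eventually_symm_extChartAt {p : M → Prop} {e : 𝔼}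
    (he : e ∈ (extChartAt (𝓡 m) z₀).target)
    (h : ∀ᶠ z in 𝓝 ((extChartAt (𝓡 m) z₀).symm e), p z) :
    ∀ᶠ y in 𝓝 e, p ((extChartAt (𝓡 m) z₀).symm y) :=
  (continuousAt_extChartAt_symm'' he).eventually h

variable [IsManifold (𝓡 m) ∞ M]

theorem isInvertible_mfderiv_symm {e : 𝔼} (he : e ∈ (extChartAt (𝓡 m) z₀).target) :
    (mfderiv 𝓘(ℝ, EuclideanSpace ℝ (Fin m)) (𝓡 m) (extChartAt (𝓡 m) z₀).symm e).IsInvertible := by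
  have := isInvertible_mfderivWithin_extChartAt_symm (I := 𝓡 m) he
  rwa [ModelWithCorners.range_eq_univ, mfderivWithin_univ] at this

theorem ofChart_toChart (X : VecField m M) {z : M} (hz : z ∈ (extChartAt (𝓡 m) z₀).source) :
    ofChart z₀ (toChart z₀ X) z = X z := by
  have A : (extChartAt (𝓡 m) z₀).symm (extChartAt (𝓡 m) z₀ z) = z :=
    (extChartAt (𝓡 m) z₀).left_inv hz
  have h1 := mfderivWithin_extChartAt_symm_comp_mfderiv_extChartAt' (I := 𝓡 m) hz
  rw [ModelWithCorners.range_eq_univ, mfderivWithin_univ] at h1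
  rw [ofChart, toChart, mpullback_apply, mpullback_apply,
    ← (isInvertible_mfderiv_extChartAt hz).inverse_comp_apply_of_right, h1, A]
  simp only [ContinuousLinearMap.inverse_id, ContinuousLinearMap.coe_id', id_eq]

theorem SmoothVecFieldAt.toChart {X : VecField m M} {e : 𝔼}
    (he : e ∈ (extChartAt (𝓡 m) z₀).target)
    (hX : SmoothVecFieldAt X ((extChartAt (𝓡 m) z₀).symm e)) :
    ContDiffAt ℝ ∞ (toChart z₀ X) e :=
  contMDiffAt_vectorSpace_iff_contDiffAt.1 <|
    ContMDiffAt.mpullback_vectorField_preimage (n := ∞) hX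
      ((contMDiffOn_extChartAt_symm z₀).contMDiffAt ((isOpen_extChartAt_target z₀).mem_nhds he))
      (isInvertible_mfderiv_symm he) (by simp)

theorem ContDiffAt.ofChart {S : 𝔼 → 𝔼} {z : M} (hz : z ∈ (extChartAt (𝓡 m) z₀).source)
    (hS : ContDiffAt ℝ ∞ S (extChartAt (𝓡 m) z₀ z)) : SmoothVecFieldAt (ofChart z₀ S) z :=
  ContMDiffAt.mpullback_vectorField_preimage (n := ∞)
    (contMDiffAt_vectorSpace_iff_contDiffAt.2 hS)
    (contMDiffAt_extChartAt' (by rwa [extChartAt_source] at hz))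
    (isInvertible_mfderiv_extChartAt hz) (by simp)

theorem mlieBracket_ofChart {S T : 𝔼 → 𝔼} {z : M} (hz : z ∈ (extChartAt (𝓡 m) z₀).source)
    (hS : ContDiffAt ℝ ∞ S (extChartAt (𝓡 m) z₀ z))
    (hT : ContDiffAt ℝ ∞ T (extChartAt (𝓡 m) z₀ z)) :
    mlieBracket (𝓡 m) (ofChart z₀ S) (ofChart z₀ T) z = ofChart z₀ (lieBracket ℝ S T) z := by
  have : IsManifold (𝓡 m) (minSmoothness ℝ 2) M := by
    rw [minSmoothness_of_isRCLikeNormedField]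
    infer_instance
  have hS' := contMDiffAt_vectorSpace_iff_contDiffAt.2 hS
  have hT' := contMDiffAt_vectorSpace_iff_contDiffAt.2 hT
  have := mpullback_mlieBracket (I := 𝓡 m) (I' := 𝓘(ℝ, EuclideanSpace ℝ (Fin m)))
    (f := extChartAt (𝓡 m) z₀) (n := ∞) (hS'.mdifferentiableAt (by simp))
    (hT'.mdifferentiableAt (by simp)) (contMDiffAt_extChartAt' (by rwa [extChartAt_source] at hz))
    (by rw [minSmoothness_of_isRCLikeNormedField]; exact ENat.LEInfty.out)
  exact this.symm.trans (congrArg (fun Z => ofChart z₀ Z z) mlieBracket_eq_lieBracket)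

theorem finrank_subspaceInChart {W : ∀ x : M, Submodule ℝ (TangentSpace (𝓡 m) x)} {e : 𝔼}
    (he : e ∈ (extChartAt (𝓡 m) z₀).target) :
    Module.finrank ℝ (subspaceInChart z₀ W e) =
      Module.finrank ℝ (W ((extChartAt (𝓡 m) z₀).symm e)) :=
  (isInvertible_mfderiv_extChartAt (I := 𝓡 m)
    ((extChartAt (𝓡 m) z₀).map_target he)).inverse.finrank_comap _

end Charts

section Germs

open scoped Topology
open Filter VectorField

variable {m n : ℕ} {M : Type*} [TopologicalSpace M]
    [ChartedSpace (EuclideanSpace ℝ (Fin m)) M] [IsManifold (𝓡 m) ∞ M]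
    {D : SmoothDistribution m M n} {F : VecField m M}

/-- The vector field `X` is, in a neighbourhood of `z`, a smooth section of `D`. -/
def SmoothDistribution.IsLocalSection (D : SmoothDistribution m M n) (X : VecField m M) (z : M) :
    Prop :=
  ∀ᶠ y in 𝓝 z, SmoothVecFieldAt X y ∧ X y ∈ D.space y

/-- The span of the values of `𝒱 + [F, 𝒱]`. -/
noncomputable def SmoothDistribution.bracketSpan (D : SmoothDistribution m M n) (F : VecField m M) (z : M) :
    Submodule ℝ (TangentSpace (𝓡 m) z) :=
  Submodule.span ℝ ((fun X : VecField m M => X z) '' D.addBracket F)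

theorem SmoothDistribution.zero_mem_fields : (0 : VecField m M) ∈ D.fields := by
  refine ⟨?_, fun x => (D.space x).zero_mem⟩
  exact (Bundle.contMDiff_zeroSection ℝ (TangentSpace (𝓡 m) : M → Type _)).contMDiffOn

theorem SmoothDistribution.mem_addBracket_left {X : VecField m M} (hX : X ∈ D.fields) :
    X ∈ D.addBracket F :=
  ⟨X, hX, 0, D.zero_mem_fields, by simp⟩

theorem SmoothDistribution.mem_addBracket_right {X : VecField m M} (hX : X ∈ D.fields) :
    mlieBracket (𝓡 m) F X ∈ D.addBracket F :=
  ⟨0, D.zero_mem_fields, X, hX, by simp⟩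

/-- Local sections of a distribution extend to global sections. -/
theorem SmoothDistribution.IsLocalSection.exists_mem_fields [T2Space M] {X : VecField m M} {z : M}
    (hX : D.IsLocalSection X z) : ∃ Y ∈ D.fields, Y =ᶠ[𝓝 z] X := by
  obtain ⟨U, hU, hUo, hzU⟩ := eventually_nhds_iff.1 hX
  obtain ⟨f, -, hf⟩ := (SmoothBumpFunction.nhds_basis_tsupport (I := 𝓡 m) z).mem_iff.1
    (hUo.mem_nhds hzU)
  refine ⟨fun y => f y • X y, ⟨?_, fun y => ?_⟩, ?_⟩
  · have hXU : ContMDiffOn (𝓡 m) (𝓡 m).tangent ∞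
        (fun x => (⟨x, X x⟩ : TangentBundle (𝓡 m) M)) U :=
      fun y hy => (hU y hy).1.contMDiffWithinAt
    exact (ContMDiffOn.smul_section_of_tsupport f.contMDiff.contMDiffOn hUo hf hXU).contMDiffOn
  · by_cases hy : y ∈ U
    · exact (D.space y).smul_mem _ (hU y hy).2
    · have : f y = 0 := image_eq_zero_of_notMem_tsupport fun h => hy (hf h)
      simp [this]
  · filter_upwards [f.eventuallyEq_one] with y hy
    rw [hy]
    exact one_smul ℝ (X y)

variable [T2Space M]

theorem SmoothDistribution.mlieBracket_mem (hD : IsInvolutive D.fields) {X Y : VecField m M}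
    {z : M} (hX : D.IsLocalSection X z) (hY : D.IsLocalSection Y z) :
    mlieBracket (𝓡 m) X Y z ∈ D.space z := by
  obtain ⟨X', hX', hXX'⟩ := hX.exists_mem_fields
  obtain ⟨Y', hY', hYY'⟩ := hY.exists_mem_fields
  rw [← hXX'.mlieBracket_vectorField_eq hYY']
  exact (hD X' hX' Y' hY').2 z

theorem SmoothDistribution.mlieBracket_mem_bracketSpan {X : VecField m M} {z : M}
    (hX : D.IsLocalSection X z) : mlieBracket (𝓡 m) F X z ∈ D.bracketSpan F z := by
  obtain ⟨X', hX', hXX'⟩ := hX.exists_mem_fields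
  rw [← EventuallyEq.rfl.mlieBracket_vectorField_eq hXX']
  exact Submodule.subset_span ⟨_, D.mem_addBracket_right hX', rfl⟩

theorem SmoothDistribution.mlieBracket_mlieBracket_mem_bracketSpan
    (hD : IsInvolutive (D.addBracket F)) {X Y : VecField m M} {z : M}
    (hX : D.IsLocalSection X z) (hY : D.IsLocalSection Y z) :
    mlieBracket (𝓡 m) X (mlieBracket (𝓡 m) F Y) z ∈ D.bracketSpan F z := by
  obtain ⟨X', hX', hXX'⟩ := hX.exists_mem_fields
  obtain ⟨Y', hY', hYY'⟩ := hY.exists_mem_fields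
  rw [← hXX'.mlieBracket_vectorField_eq (EventuallyEq.rfl.mlieBracket_vectorField hYY')]
  exact Submodule.subset_span
    ⟨_, hD _ (D.mem_addBracket_left hX') _ (D.mem_addBracket_right hY'), rfl⟩

theorem SmoothDistribution.space_le_bracketSpan (z : M) : D.space z ≤ D.bracketSpan F z := by
  obtain ⟨U, hU, hzU, V, hV⟩ := D.exists_basis z
  rw [← hV.span_eq z hzU, Submodule.span_le]
  rintro _ ⟨i, rfl⟩
  have hs : D.IsLocalSection (V i) z := by
    filter_upwards [hU.mem_nhds hzU] with y hy
    refine ⟨(hV.smooth i).contMDiffAt (hU.mem_nhds hy), ?_⟩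
    rw [← hV.span_eq y hy]
    exact Submodule.subset_span ⟨i, rfl⟩
  obtain ⟨X, hX, hXV⟩ := hs.exists_mem_fields
  exact Submodule.subset_span ⟨X, D.mem_addBracket_left hX, hXV.self_of_nhds⟩

end Germs

section LocalToChart

open scoped Topology
open Filter VectorField

variable {m n : ℕ} {M : Type*} [TopologicalSpace M]
    [ChartedSpace (EuclideanSpace ℝ (Fin m)) M] [IsManifold (𝓡 m) ∞ M]
    {D : SmoothDistribution m M n} {F : VecField m M} {z₀ : M}

local notation "𝔼" => EuclideanSpace ℝ (Fin m)

theorem IsSectionNear.ofChart {S : 𝔼 → 𝔼} {e : 𝔼} (he : e ∈ (extChartAt (𝓡 m) z₀).target)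
    (hS : IsSectionNear (subspaceInChart z₀ D.space) S e) :
    D.IsLocalSection (ofChart z₀ S) ((extChartAt (𝓡 m) z₀).symm e) := by
  have hs := (extChartAt (𝓡 m) z₀).map_target he
  filter_upwards [eventually_extChartAt he hS,
    (isOpen_extChartAt_source (I := 𝓡 m) z₀).mem_nhds hs] with z hz hzs
  refine ⟨hz.1.ofChart hzs, ?_⟩
  have h := (mem_subspaceInChart ((extChartAt (𝓡 m) z₀).map_source hzs) S).1 hz.2
  rwa [(extChartAt (𝓡 m) z₀).left_inv hzs] at h

theorem SmoothDistribution.IsLocalSection.toChart {X : VecField m M} {e : 𝔼}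
    (he : e ∈ (extChartAt (𝓡 m) z₀).target)
    (hX : D.IsLocalSection X ((extChartAt (𝓡 m) z₀).symm e)) :
    IsSectionNear (subspaceInChart z₀ D.space) (toChart z₀ X) e := by
  filter_upwards [eventually_symm_extChartAt he hX, (isOpen_extChartAt_target z₀).mem_nhds he]
    with y hy hyt
  refine ⟨hy.1.toChart hyt, ?_⟩
  rw [mem_subspaceInChart hyt, ofChart_toChart X ((extChartAt (𝓡 m) z₀).map_target hyt)]
  exact hy.2

theorem mlieBracket_ofChart_toChart (hF : SmoothVecFieldOn F Set.univ) {T : 𝔼 → 𝔼} {z : M}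
    (hz : z ∈ (extChartAt (𝓡 m) z₀).source)
    (hT : ContDiffAt ℝ ∞ T (extChartAt (𝓡 m) z₀ z)) :
    mlieBracket (𝓡 m) F (ofChart z₀ T) z =
      ofChart z₀ (lieBracket ℝ (toChart z₀ F) T) z := by
  have hFF : F =ᶠ[𝓝 z] ofChart z₀ (toChart z₀ F) := by
    filter_upwards [(isOpen_extChartAt_source (I := 𝓡 m) z₀).mem_nhds hz] with y hy
    exact (ofChart_toChart F hy).symm
  refine (hFF.mlieBracket_vectorField_eq EventuallyEq.rfl).trans ?_
  refine mlieBracket_ofChart hz (SmoothVecFieldAt.toChart ((extChartAt (𝓡 m) z₀).map_source hz) ?_)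
    hT
  exact hF.contMDiffAt univ_mem

theorem mlieBracket_ofChart_mlieBracket (hF : SmoothVecFieldOn F Set.univ) {S T : 𝔼 → 𝔼} {z : M}
    (hz : z ∈ (extChartAt (𝓡 m) z₀).source)
    (hS : ContDiffAt ℝ ∞ S (extChartAt (𝓡 m) z₀ z))
    (hT : ∀ᶠ y in 𝓝 (extChartAt (𝓡 m) z₀ z), ContDiffAt ℝ ∞ T y) :
    mlieBracket (𝓡 m) (ofChart z₀ S) (mlieBracket (𝓡 m) F (ofChart z₀ T)) z =
      ofChart z₀ (lieBracket ℝ S (lieBracket ℝ (toChart z₀ F) T)) z := by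
  have hFT : mlieBracket (𝓡 m) F (ofChart z₀ T) =ᶠ[𝓝 z]
      ofChart z₀ (lieBracket ℝ (toChart z₀ F) T) := by
    have hc := continuousAt_extChartAt' (I := 𝓡 m) hz
    filter_upwards [(isOpen_extChartAt_source (I := 𝓡 m) z₀).mem_nhds hz, hc.eventually hT]
      with y hy hyT
    exact mlieBracket_ofChart_toChart hF hy hyT
  rw [EventuallyEq.rfl.mlieBracket_vectorField_eq hFT]
  refine mlieBracket_ofChart hz hS (ContDiffAt.lieBracket_vectorField (m := ∞) (n := ∞)
    (SmoothVecFieldAt.toChart ((extChartAt (𝓡 m) z₀).map_source hz) ?_) hT.self_of_nhds (by simp))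
  exact hF.contMDiffAt univ_mem

/-- The linear map with given values on the standard basis. -/
noncomputable def frameMap (n : ℕ) (E : Type*) [NormedAddCommGroup E] [NormedSpace ℝ E] :
    (Fin n → E) →L[ℝ] (Fin n → ℝ) →L[ℝ] E :=
  ∑ i, ((ContinuousLinearMap.smulRightL ℝ (Fin n → ℝ) E
    (ContinuousLinearMap.proj i)).comp (ContinuousLinearMap.proj i))

theorem frameMap_toLinearMap {n : ℕ} {E : Type*} [NormedAddCommGroup E] [NormedSpace ℝ E]
    (v : Fin n → E) : (frameMap n E v).toLinearMap = Fintype.linearCombination ℝ v := by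
  ext i
  simp [frameMap, Fintype.linearCombination_apply]

/-- A smooth local basis of a distribution, in a chart. -/
theorem SmoothDistribution.exists_frame_toChart (D : SmoothDistribution m M n) (z₀ : M) :
    ∃ X : 𝔼 → (Fin n → ℝ) →L[ℝ] 𝔼, ∀ᶠ e in 𝓝 (extChartAt (𝓡 m) z₀ z₀),
      ContDiffAt ℝ ∞ X e ∧ Function.Injective (X e) ∧
        (X e).range = subspaceInChart z₀ D.space e := by
  obtain ⟨U, hU, hzU, V, hV⟩ := D.exists_basis z₀
  refine ⟨fun e => frameMap n 𝔼 fun i => toChart z₀ (V i) e, ?_⟩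
  have ht := mem_extChartAt_target (I := 𝓡 m) z₀
  filter_upwards [(isOpen_extChartAt_target z₀).mem_nhds ht, eventually_symm_extChartAt ht
    (show ∀ᶠ z in _, z ∈ U from hU.mem_nhds (by rwa [extChartAt_to_inv]))] with e he heU
  obtain ⟨A, hA⟩ := (isInvertible_mfderiv_symm he).inverse
  have hVA : ∀ i, toChart z₀ (V i) e = A (V i ((extChartAt (𝓡 m) z₀).symm e)) := fun i => by
    exact (DFunLike.congr_fun hA _).symm
  refine ⟨?_, ?_, ?_⟩
  · refine (frameMap n 𝔼).contDiff.contDiffAt.comp e (contDiffAt_pi.2 fun i => ?_)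
    exact SmoothVecFieldAt.toChart he ((hV.smooth i).contMDiffAt (hU.mem_nhds heU))
  · have h1 : LinearIndependent ℝ fun i => toChart z₀ (V i) e := by
      simp only [hVA]
      exact (hV.linearIndependent _ heU).map' A.toLinearMap A.toLinearEquiv.ker
    have h2 := linearIndependent_iff_injective_fintypeLinearCombination.1 h1
    rwa [← frameMap_toLinearMap] at h2
  · rw [frameMap_toLinearMap, Fintype.range_linearCombination]
    apply le_antisymm
    · rw [Submodule.span_le]
      rintro _ ⟨i, rfl⟩
      rw [SetLike.mem_coe, mem_subspaceInChart he,
        ofChart_toChart _ ((extChartAt (𝓡 m) z₀).map_target he), ← hV.span_eq _ heU]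
      exact Submodule.subset_span ⟨i, rfl⟩
    · rw [subspaceInChart, ← hV.span_eq _ heU]
      refine ContinuousLinearMap.IsInvertible.comap_span_le (E₁ := 𝔼)
        (isInvertible_mfderiv_extChartAt (I := 𝓡 m)
          ((extChartAt (𝓡 m) z₀).map_target he)).inverse ?_
      rintro _ ⟨i, rfl⟩
      refine ⟨_, Submodule.subset_span ⟨i, rfl⟩, ?_⟩
      exact (ofChart_symm_apply he (toChart z₀ (V i))).symm.trans
        (ofChart_toChart _ ((extChartAt (𝓡 m) z₀).map_target he))

end LocalToChart

open VectorField Filter Topology in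
theorem mainTheorem8 {m n : ℕ} {M : Type*} [TopologicalSpace M] [T2Space M]
    [ChartedSpace (EuclideanSpace ℝ (Fin m)) M] [IsManifold (𝓡 m) ∞ M]
    (𝒱 : SmoothDistribution m M n) (h𝒱 : IsInvolutive 𝒱.fields)
    (F : VecField m M) (hF : SmoothVecFieldOn F Set.univ)
    (hdim : ∀ z : M, dimAt (𝒱.addBracket F) z = 2 * n)
    (h𝒲 : IsInvolutive (𝒱.addBracket F)) (z₀ : M) :
    ∃ U : Set M, IsOpen U ∧ z₀ ∈ U ∧ ∃ V : Fin n → VecField m M,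
      IsSmoothBasisOn 𝒱.space V U ∧
      (∀ i j, ∀ z ∈ U, VectorField.mlieBracket (𝓡 m) (V i) (V j) z = 0) ∧
      (∀ i j, ∀ z ∈ U, VectorField.mlieBracket (𝓡 m) (V i)
        (VectorField.mlieBracket (𝓡 m) F (V j)) z ∈ 𝒱.space z) := by
  obtain ⟨X, hX⟩ := 𝒱.exists_frame_toChart z₀
  have ht := mem_extChartAt_target (I := 𝓡 m) z₀
  have htev := (isOpen_extChartAt_target (I := 𝓡 m) z₀).mem_nhds ht
  have hsrc : ∀ {e}, e ∈ (extChartAt (𝓡 m) z₀).target →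
      (extChartAt (𝓡 m) z₀).symm e ∈ (extChartAt (𝓡 m) z₀).source :=
    fun he => (extChartAt (𝓡 m) z₀).map_target he
  obtain ⟨X', hX'⟩ := exists_normal_frame (F := toChart z₀ F)
    (W := subspaceInChart z₀ (𝒱.bracketSpan F)) hX
    (by
      filter_upwards [htev] with e he
      exact SmoothVecFieldAt.toChart he (hF.contMDiffAt univ_mem))
    (by
      filter_upwards [htev] with e he S T hS hT
      rw [mem_subspaceInChart he, ← mlieBracket_ofChart (hsrc he)
        (by rw [(extChartAt (𝓡 m) z₀).right_inv he]; exact hS.self_of_nhds.1)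
        (by rw [(extChartAt (𝓡 m) z₀).right_inv he]; exact hT.self_of_nhds.1)]
      exact SmoothDistribution.mlieBracket_mem h𝒱 (hS.ofChart he) (hT.ofChart he))
    (by
      filter_upwards [htev] with e he S T hS hT
      rw [mem_subspaceInChart he, ← mlieBracket_ofChart_mlieBracket hF (hsrc he)
        (by rw [(extChartAt (𝓡 m) z₀).right_inv he]; exact hS.self_of_nhds.1)
        (by rw [(extChartAt (𝓡 m) z₀).right_inv he]; exact hT.mono fun y hy => hy.1)]
      exact SmoothDistribution.mlieBracket_mlieBracket_mem_bracketSpan h𝒲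
        (hS.ofChart he) (hT.ofChart he))
    (by
      filter_upwards [htev] with e he T hT
      rw [mem_subspaceInChart he, ← mlieBracket_ofChart_toChart hF (hsrc he)
        (by rw [(extChartAt (𝓡 m) z₀).right_inv he]; exact hT.self_of_nhds.1)]
      exact SmoothDistribution.mlieBracket_mem_bracketSpan (hT.ofChart he))
    (Eventually.of_forall fun e => Submodule.comap_mono (𝒱.space_le_bracketSpan _))
    (by
      filter_upwards [htev] with e he
      rw [finrank_subspaceInChart he, Module.finrank_fin_fun]
      exact hdim _)
    (by
      refine ContinuousLinearMap.IsInvertible.comap_span_le (E₁ := EuclideanSpace ℝ (Fin m))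
        (isInvertible_mfderiv_extChartAt (I := 𝓡 m) (hsrc ht)).inverse ?_
      rintro _ ⟨_, ⟨V₁, hV₁, V₂, hV₂, rfl⟩, rfl⟩
      have hsec : ∀ {V z}, V ∈ 𝒱.fields → 𝒱.IsLocalSection V z := fun hV =>
        Eventually.of_forall fun y => ⟨hV.1.contMDiffAt univ_mem, hV.2 y⟩
      have h₂ := (hsec hV₂).toChart ht
      refine ⟨_, Submodule.subset_span ⟨toChart z₀ V₁ (extChartAt (𝓡 m) z₀ z₀),
        ((hsec hV₁).toChart ht).self_of_nhds.2, toChart z₀ V₂, h₂, rfl⟩, ?_⟩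
      refine (ofChart_symm_apply ht (toChart z₀ V₁ +
        lieBracket ℝ (toChart z₀ F) (toChart z₀ V₂))).symm.trans ?_
      refine (ofChart_add _ _ _).trans (congrArg₂ (· + ·) (ofChart_toChart _ (hsrc ht)) ?_)
      · rw [← mlieBracket_ofChart_toChart hF (hsrc ht)
          (by rw [(extChartAt (𝓡 m) z₀).right_inv ht]; exact h₂.self_of_nhds.1)]
        refine EventuallyEq.rfl.mlieBracket_vectorField_eq ?_
        filter_upwards [(isOpen_extChartAt_source (I := 𝓡 m) z₀).mem_nhds (hsrc ht)] with y hy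
        exact ofChart_toChart V₂ hy)
  have hc := continuousAt_extChartAt (I := 𝓡 m) z₀
  obtain ⟨U, hU, hUo, hzU⟩ := eventually_nhds_iff.1
    ((hc.eventually hX'.eventually_nhds).and (extChartAt_source_mem_nhds (I := 𝓡 m) z₀))
  refine ⟨U, hUo, hzU, fun i => ofChart z₀ fun e => X' e (Pi.single i 1), ?_, ?_, ?_⟩
  · have hsm : ∀ i, ∀ z ∈ U, SmoothVecFieldAt (ofChart z₀ fun e => X' e (Pi.single i 1)) z :=
      fun i z hz => ContDiffAt.ofChart (hU z hz).2
        ((hU z hz).1.self_of_nhds.1.clm_apply contDiffAt_const)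
    have hli : ∀ z ∈ U, LinearIndependent ℝ
        fun i => ofChart z₀ (fun e => X' e (Pi.single i 1)) z := by
      intro z hz
      obtain ⟨A, hA⟩ := (isInvertible_mfderiv_extChartAt (I := 𝓡 m) (hU z hz).2).inverse
      have h1 : LinearIndependent ℝ fun i => X' (extChartAt (𝓡 m) z₀ z) (Pi.single i 1) :=
        (Pi.linearIndependent_single_one (Fin n) ℝ).map' (X' (extChartAt (𝓡 m) z₀ z)).toLinearMap
          (LinearMap.ker_eq_bot.2 (hU z hz).1.self_of_nhds.2.1)
      have h2 := h1.map' A.toLinearMap A.toLinearEquiv.ker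
      have h3 : (fun i => ofChart z₀ (fun e => X' e (Pi.single i 1)) z) =
          fun i => A (X' (extChartAt (𝓡 m) z₀ z) (Pi.single i 1)) :=
        funext fun i => (DFunLike.congr_fun hA _).symm
      rw [h3]
      exact h2
    refine ⟨fun i z hz => (hsm i z hz).contMDiffWithinAt, hli, fun z hz => ?_⟩
    have hz' := (hU z hz).1.self_of_nhds
    obtain ⟨e, he, rfl⟩ : ∃ e ∈ (extChartAt (𝓡 m) z₀).target, (extChartAt (𝓡 m) z₀).symm e = z :=
      ⟨_, (extChartAt (𝓡 m) z₀).map_source (hU z hz).2, (extChartAt (𝓡 m) z₀).left_inv (hU z hz).2⟩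
    rw [(extChartAt (𝓡 m) z₀).right_inv he] at hz'
    have hfin : Module.Finite ℝ (TangentSpace (𝓡 m) ((extChartAt (𝓡 m) z₀).symm e)) :=
      inferInstanceAs (Module.Finite ℝ (EuclideanSpace ℝ (Fin m)))
    refine Submodule.eq_of_le_of_finrank_eq ?_ ?_
    · rw [Submodule.span_le]
      rintro _ ⟨i, rfl⟩
      rw [SetLike.mem_coe, ← mem_subspaceInChart he, ← hz'.2.2.1]
      exact ⟨_, rfl⟩
    · rw [finrank_span_eq_card (hli _ hz), ← finrank_subspaceInChart he, ← hz'.2.2.1,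
        LinearMap.finrank_range_of_inj hz'.2.1]
      simp
  · intro i j z hz
    have hz' := (hU z hz).1.self_of_nhds
    have hsmooth : ∀ i, ContDiffAt ℝ ∞ (fun e => X' e (Pi.single i 1)) (extChartAt (𝓡 m) z₀ z) :=
      fun i => hz'.1.clm_apply contDiffAt_const
    rw [mlieBracket_ofChart (hU z hz).2 (hsmooth i) (hsmooth j)]
    exact (congrArg _ (hz'.2.2.2.1 _ _)).trans (map_zero _)
  · intro i j z hz
    have hev := (hU z hz).1
    have hsmooth : ∀ i, ∀ᶠ e in 𝓝 (extChartAt (𝓡 m) z₀ z),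
        ContDiffAt ℝ ∞ (fun e => X' e (Pi.single i 1)) e :=
      fun i => hev.mono fun e he => he.1.clm_apply contDiffAt_const
    rw [mlieBracket_ofChart_mlieBracket hF (hU z hz).2 (hsmooth i).self_of_nhds (hsmooth j)]
    have h1 := hev.self_of_nhds.2.2.2.2 (Pi.single i 1) (Pi.single j 1)
    rw [mem_subspaceInChart ((extChartAt (𝓡 m) z₀).map_source (hU z hz).2),
      (extChartAt (𝓡 m) z₀).left_inv (hU z hz).2] at h1
    exact h1
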